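/- Let $X,Y$ be real Hilbert spaces, $\phi:X\to(-\infty,+\infty]$ proper, closed and convex, $\mathfrak A\subset Y$ nonempty, closed, convex and bounded, $A_k\in\mathcal L(X,Y)$, $x_k,z\in X$, $b_k\in Y$, $r>0$. Put $\ell_k(x)=A_k(x-x_k)+b_k$, $\sigma_{\mathfrak A}(y)=\sup_{\theta\in\mathfrak A}(\theta,y)_Y$, $\psi_k=\sigma_{\mathfrak A}\circ\ell_k+\phi$, $\mathrm{prox}_\psi(x)=\arg\min_{x'}\{\tfrac12\|x'-x\|_X^2+\psi(x')\}$, and let $$d(\theta)=\min_{x\in X}\Big\{\tfrac1{2r}\|x-z\|_X^2+\phi(x)+(\theta,\ell_k(x))_Y\Big\}.$$ The dual problem is $\max_{\theta\in\mathfrak A}d(\theta)$. Dual spectral projected gradient method. Given are $\theta^{(1)}\in\mathfrak A$, $0<\gamma_{\min}<\gamma_{\max}<\infty$, $\gamma^{(1)}\in[\gamma_{\min},\gamma_{\max}]$, $\lambda_0\in(0,1]$, $0<\sigma_1<\sigma_2<1$, $\alpha\in(0,1)$, $\beta\in[\sigma_1,\sigma_2]$ and an integer $M\ge1$. For $n=1,2,\dots$: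 1. $p^{(n)}=\mathrm{prox}_{r\phi}(z-rA_k^*\theta^{(n)})$ and $\mu^{(n)}=\ell_k(p^{(n)})$. 2. If $n>1$, then $\gamma^{(n)}=\min\{\gamma_{\max},\max\{\gamma_{\min},\lambda^{(n-1)}\|s^{(n-1)}\|_Y^2/(\mu^{(n-1)}-\mu^{(n)},s^{(n-1)})_Y\}\}$; if the denominator is $0$, $\gamma^{(n)}$ may be any element of $[\gamma_{\min},\gamma_{\max}]$. 3. $s^{(n)}=\mathrm{proj}_{\mathfrak A}(\theta^{(n)}+\gamma^{(n)}\mu^{(n)})-\theta^{(n)}$ and $d_{\min}=\min\{d(\theta^{(n-j)}):0\le j\le\min\{n-1,M-1\}\}$. 4. Start with $\lambda=\lambda_0$. While $d(\theta^{(n)}+\lambda s^{(n)})<d_{\min}+\alpha\lambda(\mu^{(n)},s^{(n)})_Y$, compute $$\delta=-\frac{\tfrac12\lambda^2(\mu^{(n)},s^{(n)})_Y}{d(\theta^{(n)}+\lambda s^{(n)})-d(\theta^{(n)})-\lambda(\mu^{(n)},s^{(n)})_Y}$$ and replace $\lambda$ by $\delta$ if $\delta\in[\sigma_1\lambda,\sigma_2\lambda]$,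 and by $\beta\lambda$ otherwise. The final value is $\lambda^{(n)}$. 5. $\theta^{(n+1)}=\theta^{(n)}+\lambda^{(n)}s^{(n)}$. Proposition. The method is well defined: it generates infinite sequences, every line search in step 4 being finite. For every sequence $\{(p^{(n)},\theta^{(n)})\}$ that it generates, there is a solution $\bar\theta\in\mathfrak A$ of the dual problem with $\theta^{(n)}\rightharpoonup\bar\theta$ weakly in $Y$, and $\mathrm{prox}_{r\psi_k}(z)=\mathrm{prox}_{r\phi}(z-rA_k^*\bar\theta)$. Suppose in addition that one of the following holds: (a) $A_k$ is a compact operator; (b) $Y$ is finite dimensional; (c) there is $\varepsilon\in(0,\min\{1,(r\|A_k\|^2)^{-1}\})$ such that $\varepsilon\le\gamma^{(n)}\le\frac{2}{r\|A_k\|^2}-\varepsilon$ and $\varepsilon\le\lambda^{(n)}\le1$ for all $n$ (with $1/0=+\infty$ if $A_k=0$). Then $p^{(n)}\to\mathrm{prox}_{r\psi_k}(z)=\mathrm{prox}_{r\phi}(z-rA_k^*\bar\theta)$ strongly in $X$. -/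

import Mathlib

open Filter Topology

noncomputable section

namespace ProxDual

variable {X Y : Type*}
  [NormedAddCommGroup X] [InnerProductSpace ℝ X]
  [NormedAddCommGroup Y] [InnerProductSpace ℝ Y]

/-- `φ : X → (-∞, +∞]` is proper, closed (lower semicontinuous) and convex
(its epigraph is convex). -/
structure ProperClosedConvex (φ : X → EReal) : Prop where
  ne_bot : ∀ x, φ x ≠ ⊥
  exists_lt_top : ∃ x, φ x < ⊤
  closed : LowerSemicontinuous φ
  convex : Convex ℝ {q : X × ℝ | φ q.1 ≤ (q.2 : EReal)}

/-- The proximity operator `prox_ψ(x) = argmin_{x'} { ½‖x' - x‖² + ψ(x') }`, as a set of minimizers;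
`prox_ψ(x) = p` is expressed as `prox ψ x = {p}`. -/
def prox (ψ : X → EReal) (x : X) : Set X :=
  {p | ∀ x' : X, ((1 / 2 * ‖p - x‖ ^ 2 : ℝ) : EReal) + ψ p
      ≤ ((1 / 2 * ‖x' - x‖ ^ 2 : ℝ) : EReal) + ψ x'}

/-- The function `r ψ`. -/
def scale (r : ℝ) (ψ : X → EReal) : X → EReal := fun x => (r : EReal) * ψ x

/-- `w` is the metric projection of `u` onto `C`. -/
def IsProj (C : Set Y) (u w : Y) : Prop :=
  w ∈ C ∧ ∀ v ∈ C, ‖u - w‖ ≤ ‖u - v‖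

/-- The support function `σ_C(y) = sup_{v ∈ C} (v, y)`. -/
def support (C : Set Y) (y : Y) : EReal :=
  ⨆ v ∈ C, ((inner ℝ v y : ℝ) : EReal)

/-- The affine map `ℓ_k(x) = A_k (x - x_k) + b_k`. -/
def ell (A : X →L[ℝ] Y) (xk : X) (b : Y) (x : X) : Y := A (x - xk) + b

/-- `ψ_k(x) = σ_𝔄(A_k (x - x_k) + b_k) + φ(x)`. -/
def psi (φ : X → EReal) (𝔄 : Set Y) (A : X →L[ℝ] Y) (xk : X) (b : Y) (x : X) : EReal :=
  support 𝔄 (ell A xk b x) + φ x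

/-- The dual objective, as an extended real:
`θ ↦ min_x { 1/(2r) ‖x - z‖² + φ(x) + (θ, A_k (x - x_k) + b_k) }`. -/
def dualFun (φ : X → EReal) (A : X →L[ℝ] Y) (xk : X) (b : Y) (z : X) (r : ℝ) (θ : Y) : EReal :=
  ⨅ x : X, ((1 / (2 * r) * ‖x - z‖ ^ 2 : ℝ) : EReal) + φ x
    + ((inner ℝ θ (ell A xk b x) : ℝ) : EReal)

/-- The dual objective `d` as a real function (for proper closed convex `φ` and `r > 0` the
infimum is attained and finite). -/
def dualObj (φ : X → EReal) (A : X →L[ℝ] Y) (xk : X) (b : Y) (z : X) (r : ℝ) (θ : Y) : ℝ :=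
  (dualFun φ A xk b z r θ).toReal

/-- `θ` solves the dual problem `max_{θ ∈ 𝔄} min_x { … }`. -/
def IsDualSolution (φ : X → EReal) (𝔄 : Set Y) (A : X →L[ℝ] Y) (xk : X) (b : Y) (z : X) (r : ℝ)
    (θ : Y) : Prop :=
  θ ∈ 𝔄 ∧ ∀ θ' ∈ 𝔄, dualFun φ A xk b z r θ' ≤ dualFun φ A xk b z r θ

/-- The user-specified scalar parameters of the method, with the requirements on them. -/
structure Params where
  γmin : ℝ
  γmax : ℝ
  /-- initial step length `γ⁽¹⁾` -/
  γ₁ : ℝ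
  lam₀ : ℝ
  σ₁ : ℝ
  σ₂ : ℝ
  α : ℝ
  β : ℝ
  /-- nonmonotone memory limit -/
  M : ℕ
  γmin_pos : 0 < γmin
  γmin_lt_γmax : γmin < γmax
  γ₁_mem : γ₁ ∈ Set.Icc γmin γmax
  lam₀_mem : lam₀ ∈ Set.Ioc (0 : ℝ) 1
  σ₁_pos : 0 < σ₁
  σ₁_lt_σ₂ : σ₁ < σ₂
  σ₂_lt_one : σ₂ < 1
  α_mem : α ∈ Set.Ioo (0 : ℝ) 1
  β_mem : β ∈ Set.Icc σ₁ σ₂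
  one_le_M : 1 ≤ M

/-- One pass through the body of the line search loop: the trial step `l` is replaced by the
maximizer `δ` of the interpolating quadratic if `δ ∈ [σ₁ l, σ₂ l]`, and by `β l` otherwise. -/
def backtrack (P : Params) (d : Y → ℝ) (θ μ s : Y) (l : ℝ) : ℝ :=
  let δ : ℝ := -((1 / 2 * l ^ 2 * inner ℝ μ s) / (d (θ + l • s) - d θ - l * inner ℝ μ s))
  if P.σ₁ * l ≤ δ ∧ δ ≤ P.σ₂ * l then δ else P.β * l

/-- `d_min = min { d(θ⁽ⁿ⁻ʲ⁾) | 0 ≤ j ≤ min{n, M-1} }`, with iterates counted from `0`. -/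
def dmin (P : Params) (d : Y → ℝ) (θ : ℕ → Y) (n : ℕ) : ℝ :=
  (Finset.range (min n (P.M - 1) + 1)).inf' ⟨0, by simp⟩ (fun j => d (θ (n - j)))

/-- The condition under which the line search loop is *left* at iteration `n` with step `l`. -/
def Accept (P : Params) (d : Y → ℝ) (θ : ℕ → Y) (μ s : Y) (n : ℕ) (l : ℝ) : Prop :=
  dmin P d θ n + P.α * l * inner ℝ μ s ≤ d (θ n + l • s)

/-- The sequences `p, θ, μ, s, γ, lam` are generated by the dual spectral projected gradient
method. Iterates are counted from `0`, so index `n` here is iteration `n + 1`.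
Where the spectral quotient has denominator zero, any safeguarded value is allowed. -/
structure IsRun [CompleteSpace X] [CompleteSpace Y]
    (φ : X → EReal) (𝔄 : Set Y) (A : X →L[ℝ] Y) (xk : X) (b : Y) (z : X) (r : ℝ)
    (P : Params) (θ₁ : Y)
    (p : ℕ → X) (θ μ s : ℕ → Y) (γ lam : ℕ → ℝ) : Prop where
  θ_zero : θ 0 = θ₁
  γ_zero : γ 0 = P.γ₁
  prox_eq : ∀ n, prox (scale r φ) (z - r • ContinuousLinearMap.adjoint A (θ n)) = {p n}
  μ_eq : ∀ n, μ n = ell A xk b (p n)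
  γ_succ : ∀ n, inner ℝ (μ n - μ (n + 1)) (s n) ≠ 0 →
    γ (n + 1) = min P.γmax (max P.γmin
      (lam n * ‖s n‖ ^ 2 / inner ℝ (μ n - μ (n + 1)) (s n)))
  γ_succ_of_eq_zero : ∀ n, inner ℝ (μ n - μ (n + 1)) (s n) = 0 →
    γ (n + 1) ∈ Set.Icc P.γmin P.γmax
  proj : ∀ n, IsProj 𝔄 (θ n + γ n • μ n) (θ n + s n)
  /-- The line search starts at `lam₀` and stops at the first acceptable trial step. -/
  line_search : ∀ n, ∃ i : ℕ,
    lam n = (backtrack P (dualObj φ A xk b z r) (θ n) (μ n) (s n))^[i] P.lam₀ ∧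
    Accept P (dualObj φ A xk b z r) θ (μ n) (s n) n (lam n) ∧
    ∀ j < i, ¬ Accept P (dualObj φ A xk b z r) θ (μ n) (s n) n
      ((backtrack P (dualObj φ A xk b z r) (θ n) (μ n) (s n))^[j] P.lam₀)
  θ_succ : ∀ n, θ (n + 1) = θ n + lam n • s n

end ProxDual

end

/-!
The iteration maximizes over `𝔄` the dual objective `d`, which is concave with gradient
`θ ↦ ℓ(p(θ))`, where `p(θ) = prox_{rφ}(z - r A* θ)`. This gradient is `r‖A‖²`-Lipschitz; all that
is needed of it are the supergradient inequality and the descent lemma (`SmoothConcave`,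
`smoothConcave_dualObj`). Both come from the quadratic growth of the Lagrangian around `p(θ)`
(`lagr_growth`).

Write `D n = (μ n, s n)`. The projection gives `‖s n‖² ≤ γmax D n`, and with the descent lemma this
shows that all short trial steps are accepted: line searches terminate, and accepted steps are
bounded away from zero.

The nonmonotone acceptance test only yields descent below the maximum `F n` of the last `M` dual
gaps. Still, `D` is summable (`summable_of_nonmonotone_descent`): if `F` decreases little over `M`
steps, then, going backwards from the index where `F (n + M)` is attained, no gap in between can
be much smaller than `F n`, and so no `D` in between can be large. Hence
`D n ≤ K (F n - F (n + M))`, which telescopes.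

Summability of `D` makes the iterates quasi-Fejér monotone with respect to every dual solution and
makes the dual gaps summable. Weak cluster points are therefore dual solutions, and Opial's lemma
gives weak convergence of the whole sequence (`SmoothConcave.tendsto_spg`). Weak limits are taken
along ultrafilters, which requires no separability.

Finally `‖p(θ̄) - p(θ)‖² ≤ 2r (d(θ̄) - d(θ))` for `θ ∈ 𝔄` and a dual solution `θ̄`
(from `dist_prox_le` and the optimality condition at `θ̄`), so the convergence of the dual values
already forces `p n → p(θ̄)` in norm. The point `p(θ̄)` is the primal solution because the support
function at `ℓ(p(θ̄))` is attained at `θ̄` (`prox_psi_eq_singleton`).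
-/

open Filter Topology

namespace ProxDual

/-! ### Proximity operators -/

section Prox

/-- First-order conditions are obtained by letting `t → 0` in this form. -/
lemma nonpos_of_forall_le_mul {a b : ℝ} (h : ∀ t : ℝ, 0 < t → t ≤ 1 → a ≤ t * b) : a ≤ 0 := by
  by_contra! ha
  have hab : a ≤ b := by simpa using h 1 one_pos le_rfl
  have hb : 0 < b := ha.trans_le hab
  have h1 := h (a / (2 * b)) (by positivity) (by rw [div_le_one (by positivity)]; linarith)
  have h2 : a / (2 * b) * b = a / 2 := by field_simp
  linarith

lemma coe_add_scale {X : Type*} {ψ : X → EReal} (hbot : ∀ x, ψ x ≠ ⊥) {x : X}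
    (hx : ψ x ≠ ⊤) (r a : ℝ) :
    (a : EReal) + scale r ψ x = ((a + r * (ψ x).toReal : ℝ) : EReal) := by
  rw [scale, EReal.coe_add, EReal.coe_mul, EReal.coe_toReal hx (hbot x)]

lemma coe_add_scale_of_eq_top {X : Type*} {ψ : X → EReal} {x : X} (hx : ψ x = ⊤) {r : ℝ}
    (hr : 0 < r) (a : ℝ) :
    (a : EReal) + scale r ψ x = ⊤ := by
  rw [scale, hx, EReal.coe_mul_top_of_pos hr, EReal.coe_add_top]

variable {X : Type*} [NormedAddCommGroup X]

/-- Membership in the proximity set, expressed with real numbers on the effective domain. -/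
lemma mem_prox_scale_iff {ψ : X → EReal} (hbot : ∀ x, ψ x ≠ ⊥) (htop : ∃ x, ψ x ≠ ⊤)
    {r : ℝ} (hr : 0 < r) {y p : X} :
    p ∈ prox (scale r ψ) y ↔ ψ p ≠ ⊤ ∧ ∀ x, ψ x ≠ ⊤ →
      1 / 2 * ‖p - y‖ ^ 2 + r * (ψ p).toReal ≤ 1 / 2 * ‖x - y‖ ^ 2 + r * (ψ x).toReal := by
  constructor
  · intro h
    have hp : ψ p ≠ ⊤ := by
      intro hp
      obtain ⟨x, hx⟩ := htop
      have := h x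
      rw [coe_add_scale_of_eq_top hp hr, coe_add_scale hbot hx, top_le_iff] at this
      exact EReal.coe_ne_top _ this
    refine ⟨hp, fun x hx => ?_⟩
    have := h x
    rw [coe_add_scale hbot hp, coe_add_scale hbot hx] at this
    exact_mod_cast this
  · rintro ⟨hp, h⟩ x
    by_cases hx : ψ x = ⊤
    · rw [coe_add_scale_of_eq_top hx hr]; exact le_top
    · rw [coe_add_scale hbot hp, coe_add_scale hbot hx]
      exact_mod_cast h x hx

/-- Quadratic growth of the proximal objective around `p` forces `prox` to be `{p}`. -/
lemma prox_scale_eq_singleton {ψ : X → EReal} (hbot : ∀ x, ψ x ≠ ⊥) {r : ℝ} (hr : 0 < r)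
    {y p : X} (hp : ψ p ≠ ⊤)
    (h : ∀ x, ψ x ≠ ⊤ → 1 / 2 * ‖p - y‖ ^ 2 + r * (ψ p).toReal + 1 / 2 * ‖x - p‖ ^ 2
      ≤ 1 / 2 * ‖x - y‖ ^ 2 + r * (ψ x).toReal) :
    prox (scale r ψ) y = {p} := by
  ext q
  rw [Set.mem_singleton_iff, mem_prox_scale_iff hbot ⟨p, hp⟩ hr]
  constructor
  · rintro ⟨hq, hmin⟩
    have h1 := h q hq
    have h2 := hmin p hp
    have h3 : ‖q - p‖ ^ 2 ≤ 0 := by linarith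
    have h4 : ‖q - p‖ = 0 := by
      have := sq_nonneg ‖q - p‖
      exact pow_eq_zero_iff (two_ne_zero) |>.1 (le_antisymm h3 this)
    exact sub_eq_zero.1 (norm_eq_zero.1 h4)
  · rintro rfl
    refine ⟨hp, fun x hx => ?_⟩
    have := h x hx
    have := sq_nonneg ‖x - q‖
    linarith

namespace ProperClosedConvex

variable [InnerProductSpace ℝ X] {φ : X → EReal} (hφ : ProperClosedConvex φ)
include hφ

lemma exists_ne_top : ∃ x, φ x ≠ ⊤ := hφ.exists_lt_top.imp fun _ h => h.ne

lemma coe_toReal {x : X} (hx : φ x ≠ ⊤) : ((φ x).toReal : EReal) = φ x :=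
  EReal.coe_toReal hx (hφ.ne_bot x)

lemma convex_comb {x y : X} (hx : φ x ≠ ⊤) (hy : φ y ≠ ⊤) {t : ℝ} (h0 : 0 ≤ t) (h1 : t ≤ 1) :
    φ (x + t • (y - x)) ≠ ⊤ ∧
      (φ (x + t • (y - x))).toReal ≤ (φ x).toReal + t * ((φ y).toReal - (φ x).toReal) := by
  have h := hφ.convex (x := (x, (φ x).toReal)) (hφ.coe_toReal hx).ge
    (y := (y, (φ y).toReal)) (hφ.coe_toReal hy).ge (sub_nonneg.2 h1) h0 (by ring)
  have e1 : (1 - t) • x + t • y = x + t • (y - x) := by module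
  simp only [Set.mem_ofPred_eq, Prod.smul_mk, Prod.mk_add_mk, smul_eq_mul, e1] at h
  have ht : φ (x + t • (y - x)) ≠ ⊤ := fun h' => by
    rw [h', top_le_iff] at h
    exact EReal.coe_ne_top _ h
  refine ⟨ht, ?_⟩
  rw [← hφ.coe_toReal ht, EReal.coe_le_coe_iff] at h
  linarith

/-- A proper closed convex function decreases at most linearly: lower semicontinuity bounds it
below on a ball, and convexity carries this bound along rays. -/
lemma exists_lower_bound : ∃ (x₀ : X) (c δ : ℝ), 0 < δ ∧
    ∀ x, φ x ≠ ⊤ → c - ‖x - x₀‖ / δ ≤ (φ x).toReal := by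
  obtain ⟨x₀, hx₀⟩ := hφ.exists_ne_top
  have hlt : (((φ x₀).toReal - 1 : ℝ) : EReal) < φ x₀ := by
    rw [← hφ.coe_toReal hx₀, EReal.coe_lt_coe_iff, EReal.toReal_coe]
    linarith
  obtain ⟨ε, hε, hball⟩ := Metric.eventually_nhds_iff.1 (hφ.closed x₀ _ hlt)
  have hnear : ∀ x, ‖x - x₀‖ < ε → φ x ≠ ⊤ → (φ x₀).toReal - 1 ≤ (φ x).toReal := by
    intro x hx hxt
    have : (((φ x₀).toReal - 1 : ℝ) : EReal) < φ x := hball (y := x) (by rwa [dist_eq_norm])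
    rw [← hφ.coe_toReal hxt, EReal.coe_lt_coe_iff] at this
    exact this.le
  refine ⟨x₀, (φ x₀).toReal - 1, ε / 2, by positivity, fun x hx => ?_⟩
  rcases lt_or_ge ‖x - x₀‖ ε with h | h
  · have := hnear x h hx
    have : 0 ≤ ‖x - x₀‖ / (ε / 2) := by positivity
    linarith
  · have hpos : 0 < ‖x - x₀‖ := hε.trans_le h
    set t := ε / 2 / ‖x - x₀‖ with ht
    have ht0 : 0 < t := by positivity
    have ht1 : t ≤ 1 := by rw [ht, div_le_one hpos]; linarith
    obtain ⟨hy, hle⟩ := hφ.convex_comb hx₀ hx ht0.le ht1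
    have hn : ‖x₀ + t • (x - x₀) - x₀‖ < ε := by
      rw [add_sub_cancel_left, norm_smul, Real.norm_of_nonneg ht0.le, ht,
        div_mul_cancel₀ _ hpos.ne']
      linarith
    have h1 := hnear _ hn hy
    have h2 : t * (‖x - x₀‖ / (ε / 2)) = 1 := by rw [ht]; field_simp
    have h3 : 0 ≤ t * ((φ x).toReal - (φ x₀).toReal + ‖x - x₀‖ / (ε / 2)) := by
      rw [mul_add, h2]; linarith
    have := nonneg_of_mul_nonneg_right h3 ht0
    linarith

/-- The strong convexity of the proximal objective: it grows quadratically around a minimizer. -/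
lemma prox_growth {r : ℝ} (hr : 0 < r) {y p : X} (hp : p ∈ prox (scale r φ) y) {x : X}
    (hx : φ x ≠ ⊤) :
    1 / 2 * ‖p - y‖ ^ 2 + r * (φ p).toReal + 1 / 2 * ‖x - p‖ ^ 2
      ≤ 1 / 2 * ‖x - y‖ ^ 2 + r * (φ x).toReal := by
  obtain ⟨hpt, hmin⟩ := (mem_prox_scale_iff hφ.ne_bot hφ.exists_ne_top hr).1 hp
  have hx' : ‖x - y‖ ^ 2 = ‖p - y‖ ^ 2 + 2 * inner ℝ (p - y) (x - p) + ‖x - p‖ ^ 2 := by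
    rw [← norm_add_sq_real]; congr 2; abel
  have key : -(inner ℝ (p - y) (x - p) + r * ((φ x).toReal - (φ p).toReal)) ≤ 0 := by
    refine nonpos_of_forall_le_mul (b := 1 / 2 * ‖x - p‖ ^ 2) fun t h0 h1 => ?_
    obtain ⟨ht, hle⟩ := hφ.convex_comb hpt hx h0.le h1
    have hm := hmin _ ht
    have hn : ‖p + t • (x - p) - y‖ ^ 2
        = ‖p - y‖ ^ 2 + 2 * (t * inner ℝ (p - y) (x - p)) + t ^ 2 * ‖x - p‖ ^ 2 := by
      rw [show p + t • (x - p) - y = (p - y) + t • (x - p) by abel, norm_add_sq_real,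
        inner_smul_right, norm_smul, mul_pow, Real.norm_eq_abs, sq_abs]
    have hr' := mul_le_mul_of_nonneg_left hle hr.le
    have : 0 ≤ t * (inner ℝ (p - y) (x - p) + r * ((φ x).toReal - (φ p).toReal)
        + t * (1 / 2 * ‖x - p‖ ^ 2)) := by nlinarith
    have := nonneg_of_mul_nonneg_right this h0
    linarith
  linarith

lemma prox_nonempty [CompleteSpace X] {r : ℝ} (hr : 0 < r) (y : X) :
    ∃ p, p ∈ prox (scale r φ) y := by
  set G : X → ℝ := fun x => 1 / 2 * ‖x - y‖ ^ 2 + r * (φ x).toReal with hG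
  set S : Set ℝ := G '' {x | φ x ≠ ⊤} with hS
  have hSne : S.Nonempty := by
    obtain ⟨x, hx⟩ := hφ.exists_ne_top
    exact ⟨G x, x, hx, rfl⟩
  have hSbdd : BddBelow S := by
    obtain ⟨x₀, c, δ, hδ, hlow⟩ := hφ.exists_lower_bound
    refine ⟨r * (c - ‖y - x₀‖ / δ) - 1 / 2 * (r / δ) ^ 2, ?_⟩
    rintro _ ⟨x, hx, rfl⟩
    have h1 := mul_le_mul_of_nonneg_left (hlow x hx) hr.le
    have h2 : ‖x - x₀‖ ≤ ‖x - y‖ + ‖y - x₀‖ := norm_sub_le_norm_sub_add_norm_sub _ _ _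
    have h3 : r * (‖x - x₀‖ / δ) ≤ r / δ * ‖x - y‖ + r * (‖y - x₀‖ / δ) := by
      have := mul_le_mul_of_nonneg_left h2 (show 0 ≤ r / δ by positivity)
      calc r * (‖x - x₀‖ / δ) = r / δ * ‖x - x₀‖ := by ring
        _ ≤ _ := this
        _ = _ := by ring
    have h4 := sq_nonneg (‖x - y‖ - r / δ)
    simp only [hG]
    nlinarith
  set m := sInf S
  have hm : ∀ x, φ x ≠ ⊤ → m ≤ G x := fun x hx => csInf_le hSbdd ⟨x, hx, rfl⟩
  have hseq : ∀ n : ℕ, ∃ x, φ x ≠ ⊤ ∧ G x < m + 1 / (n + 1) := fun n => by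
    obtain ⟨_, ⟨x, hx, rfl⟩, h⟩ :=
      exists_lt_of_csInf_lt hSne (show sInf S < m + 1 / ((n : ℝ) + 1) by
        have : (0 : ℝ) < 1 / (n + 1) := by positivity
        linarith)
    exact ⟨x, hx, h⟩
  choose u hu huG using hseq
  -- The parallelogram identity makes a minimizing sequence Cauchy.
  have hpar : ∀ i j, ‖u i - u j‖ ^ 2 ≤ 4 * (1 / ((i : ℝ) + 1) + 1 / (j + 1)) := by
    intro i j
    obtain ⟨ht, hle⟩ := hφ.convex_comb (hu i) (hu j) (t := 1 / 2) (by norm_num) (by norm_num)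
    have h1 := hm _ ht
    have h2 := huG i
    have h3 := huG j
    simp only [hG] at h1 h2 h3
    have h4 := parallelogram_law_with_norm ℝ (u i - y) (u j - y)
    have e1 : u i + (1 / 2 : ℝ) • (u j - u i) - y = (1 / 2 : ℝ) • (u i - y + (u j - y)) := by
      module
    rw [e1, norm_smul] at h1
    rw [sub_sub_sub_cancel_right] at h4
    have h5 := mul_le_mul_of_nonneg_left hle hr.le
    norm_num [mul_pow] at h1
    nlinarith
  have hdec : Tendsto (fun n : ℕ => Real.sqrt (8 * (1 / ((n : ℝ) + 1)))) atTop (𝓝 0) := by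
    have := (tendsto_one_div_add_atTop_nhds_zero_nat (𝕜 := ℝ)).const_mul 8
    have h2 := (Real.continuous_sqrt.tendsto _).comp this
    rwa [mul_zero, Real.sqrt_zero] at h2
  have hcau : CauchySeq u := by
    refine cauchySeq_of_le_tendsto_0 _ (fun i j N hi hj => ?_) hdec
    rw [dist_eq_norm]
    refine Real.le_sqrt_of_sq_le ((hpar i j).trans ?_)
    have h1 := Nat.one_div_le_one_div (α := ℝ) hi
    have h2 := Nat.one_div_le_one_div (α := ℝ) hj
    linarith
  obtain ⟨p, hp⟩ := cauchySeq_tendsto_of_complete hcau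
  have hlim : Tendsto (fun n : ℕ => (m + 1 / ((n : ℝ) + 1) - 1 / 2 * ‖u n - y‖ ^ 2) / r) atTop
      (𝓝 ((m - 1 / 2 * ‖p - y‖ ^ 2) / r)) := by
    have h1 := (tendsto_one_div_add_atTop_nhds_zero_nat (𝕜 := ℝ)).const_add m
    have h2 := (((hp.sub_const y).norm.pow 2).const_mul (1 / 2 : ℝ))
    simpa using (h1.sub h2).div_const r
  have hval : φ p ≤ (((m - 1 / 2 * ‖p - y‖ ^ 2) / r : ℝ) : EReal) := by
    -- By lower semicontinuity, every real `c < φ p` is eventually below `φ (u n)`.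
    refine EReal.ge_of_forall_gt_iff_ge.1 fun c hc => EReal.coe_le_coe_iff.2 ?_
    refine ge_of_tendsto hlim ((hp.eventually (hφ.closed p _ hc)).mono fun n hn => ?_)
    have hn' : (c : EReal) < φ (u n) := hn
    rw [← hφ.coe_toReal (hu n), EReal.coe_lt_coe_iff] at hn'
    have h1 := huG n
    simp only [hG] at h1
    rw [le_div_iff₀ hr]
    nlinarith
  have hpt : φ p ≠ ⊤ := fun h => by
    rw [h, top_le_iff] at hval
    exact EReal.coe_ne_top _ hval
  refine ⟨p, (mem_prox_scale_iff hφ.ne_bot hφ.exists_ne_top hr).2 ⟨hpt, fun x hx => ?_⟩⟩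
  have h1 := hm x hx
  rw [← hφ.coe_toReal hpt, EReal.coe_le_coe_iff, le_div_iff₀ hr] at hval
  simp only [hG] at h1
  linarith

lemma exists_prox_eq_singleton [CompleteSpace X] {r : ℝ} (hr : 0 < r) (y : X) :
    ∃ p, prox (scale r φ) y = {p} := by
  obtain ⟨p, hp⟩ := hφ.prox_nonempty hr y
  refine ⟨p, prox_scale_eq_singleton hφ.ne_bot hr
    ((mem_prox_scale_iff hφ.ne_bot hφ.exists_ne_top hr).1 hp).1 fun x hx => ?_⟩
  exact hφ.prox_growth hr hp hx

end ProperClosedConvex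

end Prox

/-! ### The dual objective -/

/-- `d` is concave with supergradient `m`, and satisfies the descent lemma with constant `L`;
equivalently `d` is concave and differentiable with `L`-Lipschitz gradient `m`. -/
structure SmoothConcave {Y : Type*} [NormedAddCommGroup Y] [InnerProductSpace ℝ Y]
    (d : Y → ℝ) (m : Y → Y) (L : ℝ) : Prop where
  le : ∀ θ θ', d θ' ≤ d θ + inner ℝ (m θ) (θ' - θ)
  ge : ∀ θ θ', d θ + inner ℝ (m θ) (θ' - θ) - L / 2 * ‖θ' - θ‖ ^ 2 ≤ d θ'

section Dual

variable {X Y : Type*} [NormedAddCommGroup X] [InnerProductSpace ℝ X] [CompleteSpace X]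
  [NormedAddCommGroup Y] [InnerProductSpace ℝ Y] [CompleteSpace Y]

omit [CompleteSpace X] [CompleteSpace Y] in
lemma ell_sub (A : X →L[ℝ] Y) (xk : X) (b : Y) (x x' : X) :
    ell A xk b x' - ell A xk b x = A (x' - x) := by
  simp only [ell, map_sub]; abel

/-- The Lagrangian `1/(2r) ‖x - z‖² + φ(x) + (θ, ℓ(x))`, meaningful where `φ x` is finite. -/
noncomputable def lagr (φ : X → EReal) (A : X →L[ℝ] Y) (xk : X) (b : Y) (z : X) (r : ℝ) (θ : Y)
    (x : X) : ℝ :=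
  1 / (2 * r) * ‖x - z‖ ^ 2 + (φ x).toReal + inner ℝ θ (ell A xk b x)

variable {φ : X → EReal} (hφ : ProperClosedConvex φ) (A : X →L[ℝ] Y) (xk : X) (b : Y) (z : X)
  {r : ℝ} (hr : 0 < r)

omit [CompleteSpace X] [CompleteSpace Y] in
lemma lagr_eq_add (φ : X → EReal) (r : ℝ) (θ θ' : Y) (x : X) :
    lagr φ A xk b z r θ' x = lagr φ A xk b z r θ x + inner ℝ (ell A xk b x) (θ' - θ) := by
  rw [lagr, lagr, real_inner_comm (θ' - θ), inner_sub_left]; ring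

include hφ hr

/-- Completing the square identifies the Lagrangian, up to a factor and a constant, with the
proximal objective at `z - r A* θ`, so it grows quadratically around the proximal point. -/
lemma lagr_growth {θ : Y} {p : X}
    (hp : p ∈ prox (scale r φ) (z - r • ContinuousLinearMap.adjoint A θ)) {x : X}
    (hx : φ x ≠ ⊤) :
    lagr φ A xk b z r θ p + 1 / (2 * r) * ‖x - p‖ ^ 2 ≤ lagr φ A xk b z r θ x := by
  have h := hφ.prox_growth hr hp hx
  set a := ContinuousLinearMap.adjoint A θ with ha
  have hsq : ∀ u : X, ‖u - (z - r • a)‖ ^ 2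
      = ‖u - z‖ ^ 2 + 2 * (r * inner ℝ θ (A (u - z))) + r ^ 2 * ‖a‖ ^ 2 := by
    intro u
    rw [show u - (z - r • a) = (u - z) + r • a by abel, norm_add_sq_real, inner_smul_right,
      norm_smul, mul_pow, Real.norm_eq_abs, sq_abs, ha, ContinuousLinearMap.adjoint_inner_right,
      real_inner_comm θ]
  have hell : ∀ u : X, inner ℝ θ (ell A xk b u)
      = inner ℝ θ (A (u - z)) + inner ℝ θ (ell A xk b z) := by
    intro u
    rw [← ell_sub A xk b z u, inner_sub_right]; ring
  rw [hsq, hsq] at h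
  simp only [lagr, hell p, hell x]
  have hr2 : 0 < 1 / r := by positivity
  have h' := mul_le_mul_of_nonneg_left h hr2.le
  have e1 : ∀ s t w v : ℝ, 1 / r * (1 / 2 * (s + 2 * (r * t) + r ^ 2 * w) + r * v)
      = 1 / (2 * r) * s + v + t + r / 2 * w := by
    intro s t w v; field_simp; ring
  have e2 : 1 / r * (1 / 2 * ‖x - p‖ ^ 2) = 1 / (2 * r) * ‖x - p‖ ^ 2 := by field_simp
  rw [mul_add, e1, e1, e2] at h'
  linarith

lemma dualFun_eq {θ : Y} {p : X}
    (hp : p ∈ prox (scale r φ) (z - r • ContinuousLinearMap.adjoint A θ)) :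
    dualFun φ A xk b z r θ = (lagr φ A xk b z r θ p : EReal) := by
  have hval : ∀ x, φ x ≠ ⊤ → ((1 / (2 * r) * ‖x - z‖ ^ 2 : ℝ) : EReal) + φ x
      + ((inner ℝ θ (ell A xk b x) : ℝ) : EReal) = (lagr φ A xk b z r θ x : EReal) := by
    intro x hx
    rw [lagr, EReal.coe_add, EReal.coe_add, hφ.coe_toReal hx]
  have hpt := ((mem_prox_scale_iff hφ.ne_bot hφ.exists_ne_top hr).1 hp).1
  refine le_antisymm ((iInf_le _ p).trans (hval p hpt).le) (le_iInf fun x => ?_)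
  by_cases hx : φ x = ⊤
  · rw [hx, EReal.coe_add_top, EReal.top_add_coe]; exact le_top
  · rw [hval x hx, EReal.coe_le_coe_iff]
    have := lagr_growth hφ A xk b z hr hp hx
    have : 0 ≤ 1 / (2 * r) * ‖x - p‖ ^ 2 := by positivity
    linarith

lemma dualObj_eq {θ : Y} {p : X}
    (hp : p ∈ prox (scale r φ) (z - r • ContinuousLinearMap.adjoint A θ)) :
    dualObj φ A xk b z r θ = lagr φ A xk b z r θ p := by
  rw [dualObj, dualFun_eq hφ A xk b z hr hp, EReal.toReal_coe]

lemma coe_dualObj (θ : Y) :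
    (dualObj φ A xk b z r θ : EReal) = dualFun φ A xk b z r θ := by
  obtain ⟨p, hp⟩ := hφ.prox_nonempty hr (z - r • ContinuousLinearMap.adjoint A θ)
  rw [dualObj_eq hφ A xk b z hr hp, dualFun_eq hφ A xk b z hr hp]

/-- The distance of two proximal points is controlled by the gap in the supergradient inequality
of the dual objective. In particular, dual objective values control the primal error. -/
lemma dist_prox_le {θ θ' : Y} {p p' : X}
    (hp : p ∈ prox (scale r φ) (z - r • ContinuousLinearMap.adjoint A θ))
    (hp' : p' ∈ prox (scale r φ) (z - r • ContinuousLinearMap.adjoint A θ')) :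
    dualObj φ A xk b z r θ' + 1 / (2 * r) * ‖p - p'‖ ^ 2
      ≤ dualObj φ A xk b z r θ + inner ℝ (ell A xk b p) (θ' - θ) := by
  have hpt := ((mem_prox_scale_iff hφ.ne_bot hφ.exists_ne_top hr).1 hp).1
  rw [dualObj_eq hφ A xk b z hr hp, dualObj_eq hφ A xk b z hr hp', ← lagr_eq_add]
  exact lagr_growth hφ A xk b z hr hp' hpt

lemma smoothConcave_dualObj {p : Y → X}
    (hp : ∀ θ, p θ ∈ prox (scale r φ) (z - r • ContinuousLinearMap.adjoint A θ)) :
    SmoothConcave (dualObj φ A xk b z r) (fun θ => ell A xk b (p θ)) (r * ‖A‖ ^ 2) where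
  le θ θ' := by
    have h := dist_prox_le hφ A xk b z hr (hp θ) (hp θ')
    have : 0 ≤ 1 / (2 * r) * ‖p θ - p θ'‖ ^ 2 := by positivity
    linarith
  ge θ θ' := by
    have hpt := ((mem_prox_scale_iff hφ.ne_bot hφ.exists_ne_top hr).1 (hp θ')).1
    have h := lagr_growth hφ A xk b z hr (hp θ) hpt
    rw [dualObj_eq hφ A xk b z hr (hp θ), dualObj_eq hφ A xk b z hr (hp θ'),
      lagr_eq_add A xk b z φ r θ θ' (p θ')]
    set u := p θ' - p θ
    have h1 : inner ℝ (ell A xk b (p θ')) (θ' - θ)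
        = inner ℝ (ell A xk b (p θ)) (θ' - θ) + inner ℝ (A u) (θ' - θ) := by
      rw [← ell_sub A xk b, ← inner_add_left]; congr 1; abel
    have h2 : -(‖A‖ * ‖u‖ * ‖θ' - θ‖) ≤ inner ℝ (A u) (θ' - θ) := by
      have h3 := abs_real_inner_le_norm (A u) (θ' - θ)
      have h4 := mul_le_mul_of_nonneg_right (A.le_opNorm u) (norm_nonneg (θ' - θ))
      linarith [neg_abs_le (inner ℝ (A u) (θ' - θ) : ℝ)]
    have h5 : ‖A‖ * ‖u‖ * ‖θ' - θ‖
        ≤ 1 / (2 * r) * ‖u‖ ^ 2 + r * ‖A‖ ^ 2 / 2 * ‖θ' - θ‖ ^ 2 := by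
      have e : 1 / (2 * r) * ‖u‖ ^ 2 + r * ‖A‖ ^ 2 / 2 * ‖θ' - θ‖ ^ 2 - ‖A‖ * ‖u‖ * ‖θ' - θ‖
          = 1 / (2 * r) * (‖u‖ - r * (‖A‖ * ‖θ' - θ‖)) ^ 2 := by field_simp; ring
      have : 0 ≤ 1 / (2 * r) * (‖u‖ - r * (‖A‖ * ‖θ' - θ‖)) ^ 2 := by positivity
      linarith
    linarith

/-- If `θ` satisfies the first-order optimality condition of the dual problem, then the proximal
point belonging to `θ` solves the primal problem: the support function at `ℓ(p)` is attained at
`θ`, so the primal objective, which the Lagrangian at `θ` minorizes, touches it at `p`. -/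
lemma prox_psi_eq_singleton {𝔄 : Set Y} {θ : Y} (hθ : θ ∈ 𝔄) {p : X}
    (hp : p ∈ prox (scale r φ) (z - r • ContinuousLinearMap.adjoint A θ))
    (hopt : ∀ v ∈ 𝔄, inner ℝ (ell A xk b p) (v - θ) ≤ 0) :
    prox (scale r (psi φ 𝔄 A xk b)) z = {p} := by
  have hpt := ((mem_prox_scale_iff hφ.ne_bot hφ.exists_ne_top hr).1 hp).1
  have hsupp : ∀ y : Y, ((inner ℝ θ y : ℝ) : EReal) ≤ support 𝔄 y := fun y =>
    le_iSup₂_of_le θ hθ le_rfl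
  have hbot' : ∀ y : Y, support 𝔄 y ≠ ⊥ := fun y h => by
    have := hsupp y
    rw [h, le_bot_iff] at this
    exact EReal.coe_ne_bot _ this
  have hsp : support 𝔄 (ell A xk b p) = ((inner ℝ θ (ell A xk b p) : ℝ) : EReal) := by
    refine le_antisymm (iSup₂_le fun v hv => EReal.coe_le_coe_iff.2 ?_) (hsupp _)
    have := hopt v hv
    rw [inner_sub_right] at this
    rw [real_inner_comm, real_inner_comm _ θ]
    linarith
  have hpsip : psi φ 𝔄 A xk b p
      = ((inner ℝ θ (ell A xk b p) + (φ p).toReal : ℝ) : EReal) := by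
    rw [psi, hsp, EReal.coe_add, hφ.coe_toReal hpt]
  refine prox_scale_eq_singleton (fun x => ?_) hr (by rw [hpsip]; exact EReal.coe_ne_top _)
    fun x hx => ?_
  · rw [psi, Ne, EReal.add_eq_bot_iff, not_or]
    exact ⟨hbot' _, hφ.ne_bot x⟩
  · have hφx : φ x ≠ ⊤ := fun h => hx (by rw [psi, h, EReal.add_top_of_ne_bot (hbot' _)])
    have hsx : support 𝔄 (ell A xk b x) ≠ ⊤ := fun h => hx (by
      rw [psi, h, EReal.top_add_of_ne_bot (hφ.ne_bot x)])
    have hle := hsupp (ell A xk b x)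
    rw [← EReal.coe_toReal hsx (hbot' _), EReal.coe_le_coe_iff] at hle
    have hg := lagr_growth hφ A xk b z hr hp hφx
    rw [hpsip, EReal.toReal_coe, psi, EReal.toReal_add hsx (hbot' _) hφx (hφ.ne_bot x)]
    simp only [lagr] at hg
    have hg' := mul_le_mul_of_nonneg_left hg hr.le
    have e : ∀ t : ℝ, r * (1 / (2 * r) * t) = 1 / 2 * t := fun t => by field_simp
    rw [mul_add, mul_add, mul_add, mul_add, mul_add, e, e, e] at hg'
    have hle' := mul_le_mul_of_nonneg_left hle hr.le
    rw [mul_add, mul_add]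
    linarith

end Dual

/-! ### Weak limits and maximizers -/

section Weak

variable {Y : Type*} [NormedAddCommGroup Y] [InnerProductSpace ℝ Y]

/-- Bounded families in a Hilbert space have a weak limit along every ultrafilter. -/
lemma exists_weak_limit [CompleteSpace Y] {ι : Type*} (U : Ultrafilter ι) {x : ι → Y} {R : ℝ}
    (hR : ∀ i, ‖x i‖ ≤ R) :
    ∃ w : Y, ∀ v : Y, Tendsto (fun i => (inner ℝ (x i) v : ℝ)) U (𝓝 (inner ℝ w v)) := by
  have hb : ∀ v i, (inner ℝ (x i) v : ℝ) ∈ Set.Icc (-(R * ‖v‖)) (R * ‖v‖) := fun v i =>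
    abs_le.1 ((abs_real_inner_le_norm _ _).trans
      (mul_le_mul_of_nonneg_right (hR i) (norm_nonneg v)))
  have hl : ∀ v, ∃ l ∈ Set.Icc (-(R * ‖v‖)) (R * ‖v‖),
      Tendsto (fun i => (inner ℝ (x i) v : ℝ)) U (𝓝 l) := fun v =>
    isCompact_Icc.ultrafilter_le_nhds (U.map fun i => (inner ℝ (x i) v : ℝ))
      (le_principal_iff.2 (Ultrafilter.mem_map.2 (Eventually.of_forall (hb v))))
  choose l hlm hl using hl
  let ℓ : Y →ₗ[ℝ] ℝ :=
    { toFun := l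
      map_add' := fun u v => tendsto_nhds_unique (hl (u + v)) (by
        simpa only [inner_add_right] using (hl u).add (hl v))
      map_smul' := fun c v => tendsto_nhds_unique (hl (c • v)) (by
        simpa only [inner_smul_right, smul_eq_mul, RingHom.id_apply] using (hl v).const_mul c) }
  refine ⟨(InnerProductSpace.toDual ℝ Y).symm (ℓ.mkContinuous R fun v => abs_le.2 (hlm v)),
    fun v => ?_⟩
  rw [InnerProductSpace.toDual_symm_apply]
  exact hl v

lemma IsProj.inner_le {C : Set Y} (hC : Convex ℝ C) {u w : Y} (h : IsProj C u w) {v : Y}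
    (hv : v ∈ C) : inner ℝ (u - w) (v - w) ≤ 0 := by
  have key : 2 * inner ℝ (u - w) (v - w) ≤ 0 := by
    refine nonpos_of_forall_le_mul (b := ‖v - w‖ ^ 2) fun t h0 h1 => ?_
    have hm : w + t • (v - w) ∈ C := hC.add_smul_sub_mem h.1 hv ⟨h0.le, h1⟩
    have h2 := pow_le_pow_left₀ (norm_nonneg _) (h.2 _ hm) 2
    rw [← sub_sub, norm_sub_sq_real (u - w), inner_smul_right, norm_smul, mul_pow,
      Real.norm_eq_abs, sq_abs] at h2
    have : 0 ≤ t * (t * ‖v - w‖ ^ 2 - 2 * inner ℝ (u - w) (v - w)) := by nlinarith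
    have := nonneg_of_mul_nonneg_right this h0
    linarith
  linarith

lemma exists_isProj [CompleteSpace Y] {C : Set Y} (hne : C.Nonempty) (hcl : IsClosed C)
    (hC : Convex ℝ C) (u : Y) : ∃ w, IsProj C u w := by
  obtain ⟨w, hw, h⟩ := exists_norm_eq_iInf_of_complete_convex hne hcl.isComplete hC u
  refine ⟨w, hw, fun v hv => h.trans_le ?_⟩
  exact ciInf_le (f := fun w : C => ‖u - w‖) ⟨0, by rintro _ ⟨_, rfl⟩; positivity⟩ ⟨v, hv⟩

/-- Closed convex sets are weakly closed. -/
lemma mem_of_weak_limit [CompleteSpace Y] {ι : Type*} {U : Filter ι} [U.NeBot] {C : Set Y}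
    (hcl : IsClosed C) (hC : Convex ℝ C) {x : ι → Y} (hx : ∀ i, x i ∈ C) {w : Y}
    (hw : ∀ v : Y, Tendsto (fun i => (inner ℝ (x i) v : ℝ)) U (𝓝 (inner ℝ w v))) : w ∈ C := by
  obtain ⟨i⟩ := U.nonempty_of_neBot
  obtain ⟨q, hq⟩ := exists_isProj ⟨x i, hx i⟩ hcl hC w
  have h1 : ∀ i, (inner ℝ (x i) (w - q) : ℝ) ≤ inner ℝ q (w - q) := fun i => by
    have := hq.inner_le hC (hx i)
    rw [real_inner_comm, inner_sub_left] at this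
    linarith
  have h2 := le_of_tendsto (hw (w - q)) (Eventually.of_forall h1)
  have h3 : (inner ℝ (w - q) (w - q) : ℝ) ≤ 0 := by rw [inner_sub_left]; linarith
  have h4 := inner_self_eq_zero.1 (le_antisymm h3 real_inner_self_nonneg)
  rw [sub_eq_zero.1 h4]
  exact hq.1

namespace SmoothConcave

variable {d : Y → ℝ} {m : Y → Y} {L : ℝ} (hd : SmoothConcave d m L)
include hd

/-- Concave functions with supergradients are weakly upper semicontinuous. -/
lemma le_of_weak_limit {ι : Type*} {U : Filter ι} [U.NeBot] {x : ι → Y} {w : Y}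
    (hw : ∀ v : Y, Tendsto (fun i => (inner ℝ (x i) v : ℝ)) U (𝓝 (inner ℝ w v))) {c : ℝ}
    (hc : Tendsto (fun i => d (x i)) U (𝓝 c)) : c ≤ d w := by
  have h1 : Tendsto (fun i => d w + (inner ℝ (x i) (m w) - inner ℝ w (m w))) U (𝓝 (d w)) := by
    simpa using ((hw (m w)).sub_const (inner ℝ w (m w))).const_add (d w)
  refine le_of_tendsto_of_tendsto' hc h1 fun i => ?_
  have := hd.le w (x i)
  rwa [real_inner_comm, inner_sub_left] at this

lemma exists_isMaxOn [CompleteSpace Y] {C : Set Y} (hne : C.Nonempty) (hcl : IsClosed C)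
    (hC : Convex ℝ C) (hb : Bornology.IsBounded C) : ∃ w ∈ C, IsMaxOn d C w := by
  obtain ⟨R, hR⟩ := hb.exists_norm_le
  obtain ⟨θ₀, hθ₀⟩ := hne
  have hbdd : BddAbove (d '' C) := by
    refine ⟨d θ₀ + ‖m θ₀‖ * (R + R), ?_⟩
    rintro _ ⟨θ, hθ, rfl⟩
    have h1 := hd.le θ₀ θ
    have h2 := real_inner_le_norm (m θ₀) (θ - θ₀)
    have h3 : ‖θ - θ₀‖ ≤ R + R := (norm_sub_le _ _).trans (add_le_add (hR _ hθ) (hR _ hθ₀))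
    have h4 := mul_le_mul_of_nonneg_left h3 (norm_nonneg (m θ₀))
    linarith
  obtain ⟨u, -, hu, hmem⟩ := exists_seq_tendsto_sSup ⟨_, Set.mem_image_of_mem d hθ₀⟩ hbdd
  choose x hx hxu using hmem
  obtain ⟨w, hw⟩ := exists_weak_limit (Ultrafilter.of (atTop : Filter ℕ)) fun i => hR _ (hx i)
  refine ⟨w, mem_of_weak_limit hcl hC hx hw, fun θ hθ => ?_⟩
  refine (le_csSup hbdd (Set.mem_image_of_mem d hθ)).trans (hd.le_of_weak_limit hw ?_)
  simp only [hxu]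
  exact hu.mono_left (Ultrafilter.of_le _)

/-- First-order optimality condition at a maximizer over a convex set. -/
lemma inner_le_of_isMaxOn {C : Set Y} (hC : Convex ℝ C) {w : Y} (hw : w ∈ C)
    (hmax : IsMaxOn d C w) {v : Y} (hv : v ∈ C) : inner ℝ (m w) (v - w) ≤ 0 := by
  refine nonpos_of_forall_le_mul (b := L / 2 * ‖v - w‖ ^ 2) fun t h0 h1 => ?_
  have hm : w + t • (v - w) ∈ C := hC.add_smul_sub_mem hw hv ⟨h0.le, h1⟩
  have h2 := hd.ge w (w + t • (v - w))
  have h3 : d (w + t • (v - w)) ≤ d w := hmax hm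
  rw [add_sub_cancel_left, inner_smul_right, norm_smul, mul_pow, Real.norm_eq_abs, sq_abs] at h2
  have : 0 ≤ t * (t * (L / 2 * ‖v - w‖ ^ 2) - inner ℝ (m w) (v - w)) := by nlinarith
  have := nonneg_of_mul_nonneg_right this h0
  linarith

end SmoothConcave

/-- Opial's lemma for bounded sequences: if all weak cluster points lie in `S`, and the distance to
every point of `S` converges, then the sequence converges weakly to a point of `S`. -/
lemma tendsto_weak_of_opial [CompleteSpace Y] {x : ℕ → Y} {R : ℝ} (hR : ∀ i, ‖x i‖ ≤ R)
    {S : Set Y}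
    (hS : ∀ (U : Ultrafilter ℕ) (w : Y), (U : Filter ℕ) ≤ atTop →
      (∀ v : Y, Tendsto (fun i => (inner ℝ (x i) v : ℝ)) U (𝓝 (inner ℝ w v))) → w ∈ S)
    (hdist : ∀ w ∈ S, ∃ a : ℝ, Tendsto (fun n => ‖x n - w‖ ^ 2) atTop (𝓝 a)) :
    ∃ w ∈ S, ∀ v : Y, Tendsto (fun i => (inner ℝ (x i) v : ℝ)) atTop (𝓝 (inner ℝ w v)) := by
  obtain ⟨w, hw⟩ := exists_weak_limit (Ultrafilter.of (atTop : Filter ℕ)) hR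
  have hwS := hS _ w (Ultrafilter.of_le _) hw
  refine ⟨w, hwS, fun v => tendsto_iff_ultrafilter _ _ _ |>.2 fun U hU => ?_⟩
  obtain ⟨w', hw'⟩ := exists_weak_limit U hR
  suffices h : w' = w by rw [← h]; exact hw' v
  obtain ⟨a, ha⟩ := hdist w hwS
  obtain ⟨a', ha'⟩ := hdist w' (hS U w' hU hw')
  -- `‖x - w‖² - ‖x - w'‖²` is affine in `x`, with linear part `2 (x, w' - w)`.
  have hlin : Tendsto (fun n => (inner ℝ (x n) (w' - w) : ℝ)) atTop
      (𝓝 ((a - a' - ‖w‖ ^ 2 + ‖w'‖ ^ 2) / 2)) := by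
    have := (((ha.sub ha').sub_const (‖w‖ ^ 2)).add_const (‖w'‖ ^ 2)).div_const 2
    refine this.congr fun n => ?_
    rw [norm_sub_sq_real, norm_sub_sq_real, inner_sub_right]
    ring
  have e1 := tendsto_nhds_unique (hw (w' - w)) (hlin.mono_left (Ultrafilter.of_le _))
  have e2 := tendsto_nhds_unique (hw' (w' - w)) (hlin.mono_left hU)
  have e3 : (inner ℝ (w' - w) (w' - w) : ℝ) = 0 := by rw [inner_sub_left, e1, e2, sub_self]
  exact sub_eq_zero.1 (inner_self_eq_zero.1 e3)

end Weak

/-! ### Real sequences -/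

/-- Nonmonotone descent. Let `F n` be the maximum of the last (at most) `M` values of `e`. If
`e (n + 1)` lies below `F n` by a multiple of `D n`, and exceeds `e n` by at most a multiple of
`D n`, then `D` is summable. The reason: if `F` decreases little over `M` steps, then following
the sequence backwards from the index where `F (n + M)` is attained, all values of `e` are close
to `F n`, hence all the `D` are small; so `D n ≤ K (F n - F (n + M))`. -/
lemma summable_of_nonmonotone_descent {e D F : ℕ → ℝ} {M : ℕ} {c C : ℝ} (hM : 1 ≤ M) (hc : 0 < c)
    (hC : 0 ≤ C) (he : ∀ n, 0 ≤ e n) (hD : ∀ n, 0 ≤ D n)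
    (hF : ∀ n, ∃ i ≤ n, n ≤ i + (M - 1) ∧ F n = e i)
    (hle : ∀ n i, i ≤ n → n ≤ i + (M - 1) → e i ≤ F n)
    (h1 : ∀ n, e (n + 1) ≤ F n - c * D n) (h2 : ∀ n, e (n + 1) ≤ e n + C * D n) :
    Summable D := by
  have hanti : Antitone F := by
    refine antitone_nat_of_succ_le fun n => ?_
    obtain ⟨i, hi, hi', h⟩ := hF (n + 1)
    rw [h]
    rcases hi.lt_or_eq with hlt | rfl
    · exact hle n i (by omega) (by omega)
    · have := h1 n
      have := mul_nonneg hc.le (hD n)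
      linarith
  have hF0 : ∀ n, 0 ≤ F n := fun n => by
    obtain ⟨i, -, -, h⟩ := hF n
    exact h ▸ he i
  set ρ := 1 + C / c with hρ
  have hρ1 : 1 ≤ ρ := by
    have : 0 ≤ C / c := by positivity
    linarith
  have hbound : ∀ n, D n ≤ ρ ^ M / c * (F n - F (n + M)) := by
    intro n
    obtain ⟨k, hk, hk', h⟩ := hF (n + M)
    set η := F n - F (n + M) with hη
    have hη0 : 0 ≤ η := sub_nonneg.2 (hanti (Nat.le_add_right n M))
    have hstep : ∀ i j, n ≤ i → F n - ρ ^ j * η ≤ e (i + 1) → c * D i ≤ ρ ^ j * η := by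
      intro i j hi hij
      have := h1 i
      have := hanti hi
      linarith
    have hback : ∀ j i, i + j = k → n ≤ i → F n - ρ ^ j * η ≤ e i := by
      intro j
      induction j with
      | zero =>
        intro i hi _
        rw [add_zero] at hi
        rw [hi, ← h, hη]
        simp
      | succ j ih =>
        intro i hi hni
        have hi1 := ih (i + 1) (by omega) (by omega)
        have hD' := hstep i j hni hi1
        have h3 : C * D i ≤ C / c * (ρ ^ j * η) := by
          calc C * D i = C / c * (c * D i) := by field_simp
            _ ≤ _ := mul_le_mul_of_nonneg_left hD' (by positivity)
        have h4 := h2 i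
        have h5 : ρ ^ (j + 1) * η = ρ ^ j * η + C / c * (ρ ^ j * η) := by rw [pow_succ, hρ]; ring
        linarith
    obtain ⟨j, rfl⟩ : ∃ j, k = n + 1 + j := ⟨k - (n + 1), by omega⟩
    have h6 := hstep n j le_rfl (hback j (n + 1) rfl (by omega))
    have h7 : ρ ^ j * η ≤ ρ ^ M * η :=
      mul_le_mul_of_nonneg_right (pow_le_pow_right₀ hρ1 (by omega)) hη0
    rw [div_mul_eq_mul_div, le_div_iff₀ hc]
    linarith
  -- `F n - F (n + M)` telescopes as the decrease of the sum of `M` consecutive values of `F`.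
  set G : ℕ → ℝ := fun n => ∑ k ∈ Finset.range M, F (n + k) with hG
  have hG' : ∀ n, F n - F (n + M) = G n - G (n + 1) := fun n => by
    have e1 := Finset.sum_range_succ (fun k => F (n + k)) M
    have e2 := Finset.sum_range_succ' (fun k => F (n + k)) M
    have e3 : G (n + 1) = ∑ k ∈ Finset.range M, F (n + (k + 1)) :=
      Finset.sum_congr rfl fun k _ => by rw [add_assoc, add_comm 1 k]
    rw [e3]
    simp only [hG, add_zero] at *
    linarith
  refine summable_of_sum_range_le (c := ρ ^ M / c * G 0) hD fun n => ?_
  calc ∑ i ∈ Finset.range n, D i ≤ ∑ i ∈ Finset.range n, ρ ^ M / c * (G i - G (i + 1)) :=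
        Finset.sum_le_sum fun i _ => hG' i ▸ hbound i
    _ = ρ ^ M / c * (G 0 - G n) := by rw [← Finset.mul_sum, Finset.sum_range_sub']
    _ ≤ ρ ^ M / c * G 0 := by
        refine mul_le_mul_of_nonneg_left ?_ (by positivity)
        have : 0 ≤ G n := Finset.sum_nonneg fun k _ => hF0 _
        linarith

/-- Quasi-Fejér monotone sequences converge, and the decrements are summable. -/
lemma quasi_fejer {a ε b : ℕ → ℝ} (ha : ∀ n, 0 ≤ a n) (hε : ∀ n, 0 ≤ ε n) (hb0 : ∀ n, 0 ≤ b n)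
    (hb : Summable b) (h : ∀ n, a (n + 1) ≤ a n - ε n + b n) :
    (∃ l, Tendsto a atTop (𝓝 l)) ∧ Summable ε := by
  have hsum : ∀ n, ∑ i ∈ Finset.range n, b i ≤ ∑' i, b i := fun n =>
    hb.sum_le_tsum _ fun i _ => hb0 i
  constructor
  · have hanti : Antitone fun n => a n - ∑ i ∈ Finset.range n, b i := by
      refine antitone_nat_of_succ_le fun n => ?_
      rw [Finset.sum_range_succ]
      linarith [h n, hε n]
    have hbdd : BddBelow (Set.range fun n => a n - ∑ i ∈ Finset.range n, b i) := by
      refine ⟨-∑' i, b i, ?_⟩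
      rintro _ ⟨n, rfl⟩
      have := ha n
      have := hsum n
      simp only
      linarith
    have h1 := (tendsto_atTop_ciInf hanti hbdd).add hb.hasSum.tendsto_sum_nat
    exact ⟨_, by simpa using h1⟩
  · refine summable_of_sum_range_le (c := a 0 + ∑' i, b i) hε fun n => ?_
    have : ∑ i ∈ Finset.range n, ε i ≤ ∑ i ∈ Finset.range n, ((a i - a (i + 1)) + b i) :=
      Finset.sum_le_sum fun i _ => by linarith [h i]
    rw [Finset.sum_add_distrib, Finset.sum_range_sub'] at this
    linarith [ha n, hsum n]

/-! ### The line search -/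

section LineSearch

lemma dmin_le {Y : Type*} (P : Params) (d : Y → ℝ) (θ : ℕ → Y) {n i : ℕ}
    (hi : i ≤ n) (hi' : n ≤ i + (P.M - 1)) : dmin P d θ n ≤ d (θ i) := by
  have h := Finset.inf'_le (s := Finset.range (min n (P.M - 1) + 1)) (fun j => d (θ (n - j)))
    (b := n - i) (by rw [Finset.mem_range]; omega)
  rwa [Nat.sub_sub_self hi] at h

lemma exists_dmin_eq {Y : Type*} (P : Params) (d : Y → ℝ) (θ : ℕ → Y) (n : ℕ) :
    ∃ i ≤ n, n ≤ i + (P.M - 1) ∧ dmin P d θ n = d (θ i) := by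
  obtain ⟨j, hj, h⟩ := Finset.exists_mem_eq_inf'
    (s := Finset.range (min n (P.M - 1) + 1)) ⟨0, by simp⟩ (fun j => d (θ (n - j)))
  rw [Finset.mem_range] at hj
  exact ⟨n - j, by omega, by omega, h⟩

lemma dmin_congr {Y : Type*} (P : Params) (d : Y → ℝ) {θ θ' : ℕ → Y} {n : ℕ}
    (h : ∀ j ≤ n, θ j = θ' j) : dmin P d θ n = dmin P d θ' n := by
  unfold dmin
  exact Finset.inf'_congr _ rfl fun j _ => by rw [h _ (Nat.sub_le n j)]

variable {Y : Type*} [NormedAddCommGroup Y] [InnerProductSpace ℝ Y]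

lemma backtrack_mem (P : Params) (d : Y → ℝ) (θ μ s : Y) {l : ℝ} (hl : 0 < l) :
    P.σ₁ * l ≤ backtrack P d θ μ s l ∧ backtrack P d θ μ s l ≤ P.σ₂ * l := by
  simp only [backtrack]
  split_ifs with h
  · exact h
  · exact ⟨mul_le_mul_of_nonneg_right P.β_mem.1 hl.le, mul_le_mul_of_nonneg_right P.β_mem.2 hl.le⟩

lemma backtrack_iterate_mem (P : Params) (d : Y → ℝ) (θ μ s : Y) (i : ℕ) :
    0 < (backtrack P d θ μ s)^[i] P.lam₀ ∧ (backtrack P d θ μ s)^[i] P.lam₀ ≤ P.σ₂ ^ i := by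
  have hσ₂ : 0 < P.σ₂ := P.σ₁_pos.trans P.σ₁_lt_σ₂
  induction i with
  | zero => simpa using P.lam₀_mem
  | succ i ih =>
    rw [Function.iterate_succ_apply']
    have h := backtrack_mem P d θ μ s ih.1
    refine ⟨(mul_pos P.σ₁_pos ih.1).trans_le h.1, h.2.trans ?_⟩
    rw [pow_succ']
    exact mul_le_mul_of_nonneg_left ih.2 hσ₂.le

lemma backtrack_iterate_le_one (P : Params) (d : Y → ℝ) (θ μ s : Y) (i : ℕ) :
    (backtrack P d θ μ s)^[i] P.lam₀ ≤ 1 :=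
  (backtrack_iterate_mem P d θ μ s i).2.trans
    (pow_le_one₀ (P.σ₁_pos.trans P.σ₁_lt_σ₂).le P.σ₂_lt_one.le)

lemma accept_congr (P : Params) (d : Y → ℝ) {θ θ' : ℕ → Y} {n : ℕ} (h : ∀ j ≤ n, θ j = θ' j)
    (μ s : Y) : Accept P d θ μ s n = Accept P d θ' μ s n := by
  funext l
  rw [Accept, Accept, dmin_congr P d h, h n le_rfl]

/-- A step length below which every trial step is accepted; the summand `1` keeps the denominator
positive when `L = 0`. -/
noncomputable def safeStep (P : Params) (L : ℝ) : ℝ := (1 - P.α) / (L / 2 * P.γmax + 1)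

lemma Params.γmax_pos (P : Params) : 0 < P.γmax := P.γmin_pos.trans P.γmin_lt_γmax

lemma safeStep_pos (P : Params) {L : ℝ} (hL : 0 ≤ L) : 0 < safeStep P L := by
  have h1 : 0 < 1 - P.α := sub_pos.2 P.α_mem.2
  have h2 := P.γmax_pos
  unfold safeStep
  positivity

/-- By the descent lemma and `‖s‖² ≤ γmax (m(θ), s)`, all sufficiently short steps are
accepted. -/
lemma SmoothConcave.accept {d : Y → ℝ} {m : Y → Y} {L : ℝ} (hd : SmoothConcave d m L)
    (hL : 0 ≤ L) (P : Params) {θ : ℕ → Y} {n : ℕ} {s : Y}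
    (hs : ‖s‖ ^ 2 ≤ P.γmax * inner ℝ (m (θ n)) s) {l : ℝ} (hl : 0 < l) (hls : l ≤ safeStep P L) :
    Accept P d θ (m (θ n)) s n l := by
  set D : ℝ := inner ℝ (m (θ n)) s
  have hγ := P.γmax_pos
  have hD : 0 ≤ D := nonneg_of_mul_nonneg_right ((sq_nonneg _).trans hs) hγ
  have h1 := hd.ge (θ n) (θ n + l • s)
  rw [add_sub_cancel_left, inner_smul_right, norm_smul, mul_pow, Real.norm_eq_abs, sq_abs] at h1
  have h2 := dmin_le P d θ (le_refl n) (Nat.le_add_right n _)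
  have h3 : L / 2 * P.γmax * l ≤ 1 - P.α := by
    rw [safeStep, le_div_iff₀ (by positivity)] at hls
    linarith
  have h4 : L / 2 * (l ^ 2 * ‖s‖ ^ 2) ≤ (1 - P.α) * (l * D) := by
    calc L / 2 * (l ^ 2 * ‖s‖ ^ 2) ≤ L / 2 * (l ^ 2 * (P.γmax * D)) := by gcongr
      _ = L / 2 * P.γmax * l * (l * D) := by ring
      _ ≤ _ := mul_le_mul_of_nonneg_right h3 (by positivity)
  rw [Accept]
  linarith

/-- Termination of the line search. -/
lemma SmoothConcave.exists_accept {d : Y → ℝ} {m : Y → Y} {L : ℝ} (hd : SmoothConcave d m L)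
    (hL : 0 ≤ L) (P : Params) {θ : ℕ → Y} {n : ℕ} {s : Y}
    (hs : ‖s‖ ^ 2 ≤ P.γmax * inner ℝ (m (θ n)) s) :
    ∃ i : ℕ, Accept P d θ (m (θ n)) s n ((backtrack P d (θ n) (m (θ n)) s)^[i] P.lam₀) := by
  obtain ⟨i, hi⟩ := exists_pow_lt_of_lt_one (safeStep_pos P hL) P.σ₂_lt_one
  have h := backtrack_iterate_mem P d (θ n) (m (θ n)) s i
  exact ⟨i, hd.accept hL P hs h.1 (h.2.trans hi.le)⟩

/-- Accepted step lengths are bounded away from zero. -/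
lemma SmoothConcave.le_step {d : Y → ℝ} {m : Y → Y} {L : ℝ} (hd : SmoothConcave d m L)
    (hL : 0 ≤ L) (P : Params) {θ : ℕ → Y} {n : ℕ} {s : Y}
    (hs : ‖s‖ ^ 2 ≤ P.γmax * inner ℝ (m (θ n)) s) {i : ℕ}
    (hi : ∀ j < i, ¬ Accept P d θ (m (θ n)) s n
      ((backtrack P d (θ n) (m (θ n)) s)^[j] P.lam₀)) :
    min P.lam₀ (P.σ₁ * safeStep P L) ≤ (backtrack P d (θ n) (m (θ n)) s)^[i] P.lam₀ := by
  cases i with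
  | zero => exact min_le_left _ _
  | succ j =>
    have h := backtrack_iterate_mem P d (θ n) (m (θ n)) s j
    have h1 : safeStep P L ≤ (backtrack P d (θ n) (m (θ n)) s)^[j] P.lam₀ := by
      by_contra! hlt
      exact hi j (Nat.lt_succ_self j) (hd.accept hL P hs h.1 hlt.le)
    rw [Function.iterate_succ_apply']
    exact (min_le_right _ _).trans ((mul_le_mul_of_nonneg_left h1 P.σ₁_pos.le).trans
      (backtrack_mem P d _ _ s h.1).1)

/-- The step length returned by the line search (junk if the search does not terminate). -/
noncomputable def stepLength (P : Params) (d : Y → ℝ) (θ : ℕ → Y) (μ s : Y) (n : ℕ) : ℝ :=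
  (backtrack P d (θ n) μ s)^[sInf {i : ℕ | Accept P d θ μ s n
    ((backtrack P d (θ n) μ s)^[i] P.lam₀)}] P.lam₀

lemma stepLength_congr (P : Params) (d : Y → ℝ) {θ θ' : ℕ → Y} {n : ℕ}
    (h : ∀ j ≤ n, θ j = θ' j) (μ s : Y) :
    stepLength P d θ μ s n = stepLength P d θ' μ s n := by
  rw [stepLength, stepLength, accept_congr P d h, h n le_rfl]

end LineSearch

/-! ### Spectral projected gradient iterations -/

section Iteration

variable {Y : Type*} [NormedAddCommGroup Y] [InnerProductSpace ℝ Y]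

/-- The variational inequality defining the projected step `s`, split into its terms. -/
lemma IsProj.step_inner_le {C : Set Y} (hC : Convex ℝ C) {θ μ s : Y} {γ : ℝ}
    (h : IsProj C (θ + γ • μ) (θ + s)) {v : Y} (hv : v ∈ C) :
    inner ℝ s (θ - v) + γ * inner ℝ μ (v - θ) + ‖s‖ ^ 2 ≤ γ * inner ℝ μ s := by
  have h1 := h.inner_le hC hv
  have e1 : θ + γ • μ - (θ + s) = γ • μ - s := by abel
  have e2 : v - (θ + s) = (v - θ) - s := by abel
  rw [e1, e2, inner_sub_right, inner_sub_left, inner_sub_left, inner_smul_left, inner_smul_left,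
    real_inner_self_eq_norm_sq] at h1
  simp only [conj_trivial] at h1
  have e3 : (inner ℝ s (θ - v) : ℝ) = -inner ℝ s (v - θ) := by
    rw [← inner_neg_right, neg_sub]
  linarith

lemma IsProj.sq_norm_step_le {C : Set Y} (hC : Convex ℝ C) {θ μ s : Y} {γ γ' : ℝ} (hγ : 0 < γ)
    (hγ' : γ ≤ γ') (hθ : θ ∈ C) (h : IsProj C (θ + γ • μ) (θ + s)) :
    0 ≤ (inner ℝ μ s : ℝ) ∧ ‖s‖ ^ 2 ≤ γ' * inner ℝ μ s := by
  have h1 := h.step_inner_le hC hθ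
  rw [sub_self, inner_zero_right, inner_zero_right, mul_zero, zero_add, zero_add] at h1
  have h2 : 0 ≤ (inner ℝ μ s : ℝ) := nonneg_of_mul_nonneg_right ((sq_nonneg _).trans h1) hγ
  exact ⟨h2, h1.trans (mul_le_mul_of_nonneg_right hγ' h2)⟩

/-- Iterates with projected directions and step lengths in `(0, 1]` remain in the convex set. -/
lemma iterate_mem {C : Set Y} (hC : Convex ℝ C) {θ s : ℕ → Y} {lam : ℕ → ℝ} (h0 : θ 0 ∈ C)
    (hs : ∀ n, θ n + s n ∈ C) (hlam : ∀ n, 0 ≤ lam n ∧ lam n ≤ 1)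
    (hsucc : ∀ n, θ (n + 1) = θ n + lam n • s n) (n : ℕ) : θ n ∈ C := by
  induction n with
  | zero => exact h0
  | succ n ih =>
    have := hC.add_smul_sub_mem ih (hs n) (hlam n)
    rwa [add_sub_cancel_left, ← hsucc] at this

/-- Weak convergence of the nonmonotone spectral projected gradient iterates to a maximizer of a
smooth concave function, together with convergence of the function values. -/
theorem SmoothConcave.tendsto_spg [CompleteSpace Y] {d : Y → ℝ} {m : Y → Y} {L : ℝ}
    (hd : SmoothConcave d m L) (hL : 0 ≤ L) (P : Params) {C : Set Y} (hcl : IsClosed C)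
    (hC : Convex ℝ C) (hbd : Bornology.IsBounded C) {θ s : ℕ → Y} {γ lam : ℕ → ℝ}
    (h0 : θ 0 ∈ C) (hγ : ∀ n, γ n ∈ Set.Icc P.γmin P.γmax)
    (hproj : ∀ n, IsProj C (θ n + γ n • m (θ n)) (θ n + s n))
    (hls : ∀ n, ∃ i : ℕ, lam n = (backtrack P d (θ n) (m (θ n)) (s n))^[i] P.lam₀ ∧
      Accept P d θ (m (θ n)) (s n) n (lam n) ∧
      ∀ j < i, ¬ Accept P d θ (m (θ n)) (s n) n
        ((backtrack P d (θ n) (m (θ n)) (s n))^[j] P.lam₀))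
    (hsucc : ∀ n, θ (n + 1) = θ n + lam n • s n) :
    ∃ w ∈ C, IsMaxOn d C w ∧
      (∀ v : Y, Tendsto (fun n => (inner ℝ (θ n) v : ℝ)) atTop (𝓝 (inner ℝ w v))) ∧
      Tendsto (fun n => d (θ n)) atTop (𝓝 (d w)) := by
  have hlam : ∀ n, 0 < lam n ∧ lam n ≤ 1 := fun n => by
    obtain ⟨i, hi, -⟩ := hls n
    rw [hi]
    exact ⟨(backtrack_iterate_mem P d _ _ _ i).1, backtrack_iterate_le_one P d _ _ _ i⟩
  have hmem : ∀ n, θ n ∈ C :=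
    iterate_mem hC h0 (fun n => (hproj n).1) (fun n => ⟨(hlam n).1.le, (hlam n).2⟩) hsucc
  set D : ℕ → ℝ := fun n => inner ℝ (m (θ n)) (s n) with hDdef
  have hγ0 : ∀ n, 0 < γ n := fun n => P.γmin_pos.trans_le (hγ n).1
  have hγmax := P.γmax_pos
  have hDs : ∀ n, 0 ≤ D n ∧ ‖s n‖ ^ 2 ≤ P.γmax * D n := fun n =>
    (hproj n).sq_norm_step_le hC (hγ0 n) (hγ n).2 (hmem n)
  set l₀ := min P.lam₀ (P.σ₁ * safeStep P L) with hl₀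
  have hl₀pos : 0 < l₀ := lt_min P.lam₀_mem.1 (mul_pos P.σ₁_pos (safeStep_pos P hL))
  have hlow : ∀ n, l₀ ≤ lam n := fun n => by
    obtain ⟨i, hi, -, hrej⟩ := hls n
    rw [hi]
    exact hd.le_step hL P (hDs n).2 hrej
  obtain ⟨v, hv, hmax⟩ := hd.exists_isMaxOn ⟨θ 0, h0⟩ hcl hC hbd
  have hDsum : Summable D := by
    refine summable_of_nonmonotone_descent (e := fun n => d v - d (θ n))
      (F := fun n => d v - dmin P d θ n) (c := P.α * l₀) (C := L / 2 * P.γmax) P.one_le_M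
      (mul_pos P.α_mem.1 hl₀pos) (by positivity) (fun n => sub_nonneg.2 (hmax (hmem n)))
      (fun n => (hDs n).1) (fun n => ?_) (fun n i hi hi' => ?_) (fun n => ?_) (fun n => ?_)
    · obtain ⟨i, hi, hi', h⟩ := exists_dmin_eq P d θ n
      exact ⟨i, hi, hi', by simp only [h]⟩
    · exact sub_le_sub_left (dmin_le P d θ hi hi') _
    · obtain ⟨i, -, hacc, -⟩ := hls n
      rw [Accept, ← hsucc] at hacc
      have h1 : P.α * l₀ * D n ≤ P.α * lam n * D n :=
        mul_le_mul_of_nonneg_right (mul_le_mul_of_nonneg_left (hlow n) P.α_mem.1.le) (hDs n).1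
      simp only [hDdef] at h1 ⊢
      linarith
    · have h1 := hd.ge (θ n) (θ (n + 1))
      rw [hsucc, add_sub_cancel_left, inner_smul_right, norm_smul, mul_pow, Real.norm_eq_abs,
        sq_abs, ← hsucc] at h1
      have h2 : 0 ≤ lam n * D n := mul_nonneg (hlam n).1.le (hDs n).1
      have h3 : lam n ^ 2 * ‖s n‖ ^ 2 ≤ P.γmax * D n := by
        have : lam n ^ 2 ≤ 1 := pow_le_one₀ (hlam n).1.le (hlam n).2
        calc lam n ^ 2 * ‖s n‖ ^ 2 ≤ 1 * ‖s n‖ ^ 2 := by gcongr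
          _ ≤ _ := by rw [one_mul]; exact (hDs n).2
      have h4 := mul_le_mul_of_nonneg_left h3 (show 0 ≤ L / 2 by positivity)
      simp only [hDdef] at h2 h4 ⊢
      linarith
  -- The iterates are quasi-Fejér monotone with respect to every maximizer `w`.
  have hfejer : ∀ w ∈ C, IsMaxOn d C w → ∀ n, ‖θ (n + 1) - w‖ ^ 2
      ≤ ‖θ n - w‖ ^ 2 - 2 * l₀ * P.γmin * (d w - d (θ n)) + 2 * P.γmax * D n := by
    intro w hw hwmax n
    have h1 := (hproj n).step_inner_le hC hw
    have h2 := hd.le (θ n) w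
    have he : 0 ≤ d w - d (θ n) := sub_nonneg.2 (hwmax (hmem n))
    have hl := hlam n
    have h3 : γ n * (d w - d (θ n)) ≤ γ n * inner ℝ (m (θ n)) (w - θ n) :=
      mul_le_mul_of_nonneg_left (by linarith) (hγ0 n).le
    have h4 : P.γmin * (d w - d (θ n)) ≤ γ n * (d w - d (θ n)) :=
      mul_le_mul_of_nonneg_right (hγ n).1 he
    have h5 : γ n * D n ≤ P.γmax * D n := mul_le_mul_of_nonneg_right (hγ n).2 (hDs n).1
    have h6 : inner ℝ (s n) (θ n - w)
        ≤ P.γmax * D n - P.γmin * (d w - d (θ n)) - ‖s n‖ ^ 2 := by linarith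
    have h7 := mul_le_mul_of_nonneg_left h6 hl.1.le
    have h8 : l₀ * (P.γmin * (d w - d (θ n))) ≤ lam n * (P.γmin * (d w - d (θ n))) :=
      mul_le_mul_of_nonneg_right (hlow n) (mul_nonneg P.γmin_pos.le he)
    have h9 : lam n * (P.γmax * D n) ≤ 1 * (P.γmax * D n) :=
      mul_le_mul_of_nonneg_right hl.2 (mul_nonneg hγmax.le (hDs n).1)
    have h10 : 0 ≤ lam n * (2 - lam n) * ‖s n‖ ^ 2 :=
      mul_nonneg (mul_nonneg hl.1.le (by linarith)) (sq_nonneg _)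
    have e1 : θ (n + 1) - w = (θ n - w) + lam n • s n := by rw [hsucc]; abel
    rw [e1, norm_add_sq_real, inner_smul_right, norm_smul, mul_pow, Real.norm_eq_abs, sq_abs,
      real_inner_comm]
    linarith
  have hqf : ∀ w ∈ C, IsMaxOn d C w → (∃ l, Tendsto (fun n => ‖θ n - w‖ ^ 2) atTop (𝓝 l)) ∧
      Summable fun n => 2 * l₀ * P.γmin * (d w - d (θ n)) := fun w hw hwmax =>
    quasi_fejer (b := fun n => 2 * P.γmax * D n) (fun n => sq_nonneg _)
      (fun n => mul_nonneg (by have := P.γmin_pos; positivity) (sub_nonneg.2 (hwmax (hmem n))))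
      (fun n => mul_nonneg (by positivity) (hDs n).1) (hDsum.mul_left _) (hfejer w hw hwmax)
  have hval : Tendsto (fun n => d (θ n)) atTop (𝓝 (d v)) := by
    have hk : 2 * l₀ * P.γmin ≠ 0 := by have := P.γmin_pos; positivity
    have h1 := ((summable_mul_left_iff hk).1 (hqf v hv hmax).2).tendsto_atTop_zero
    simpa using h1.const_sub (d v)
  obtain ⟨R, hR⟩ := hbd.exists_norm_le
  obtain ⟨w, ⟨hwC, hwmax⟩, hw⟩ := tendsto_weak_of_opial (fun n => hR _ (hmem n))
    (S := {w | w ∈ C ∧ IsMaxOn d C w})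
    (fun U w hU hw => ⟨mem_of_weak_limit hcl hC hmem hw, fun u hu =>
      (show d u ≤ d v from hmax hu).trans (hd.le_of_weak_limit hw (hval.mono_left hU))⟩)
    (fun w hw => (hqf w hw.1 hw.2).1)
  refine ⟨w, hwC, hwmax, hw, ?_⟩
  rwa [le_antisymm (show d w ≤ d v from hmax hwC) (show d v ≤ d w from hwmax hv)]

end Iteration

/-! ### Existence of runs -/

/-- Recursion in which the next term may depend on all preceding ones. -/
lemma exists_seq_of_history {Y Z : Type*} (y₀ : Y) (g₀ : Z) (F : ℕ → (ℕ → Y) → Z → Y × Z)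
    (hF : ∀ n h h' g, (∀ j ≤ n, h j = h' j) → F n h g = F n h' g) :
    ∃ (y : ℕ → Y) (g : ℕ → Z), y 0 = y₀ ∧ g 0 = g₀ ∧
      ∀ n, (y (n + 1), g (n + 1)) = F n y (g n) := by
  let S : ℕ → (ℕ → Y) × Z := fun n => Nat.rec (fun _ => y₀, g₀)
    (fun n S => (Function.update S.1 (n + 1) (F n S.1 S.2).1, (F n S.1 S.2).2)) n
  have hagree : ∀ n, ∀ j ≤ n, (S n).1 j = (S j).1 j := by
    intro n
    induction n with
    | zero => intro j hj; rw [Nat.le_zero.1 hj]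
    | succ n ih =>
      intro j hj
      rcases hj.lt_or_eq with hlt | rfl
      · exact (Function.update_of_ne hlt.ne _ _).trans (ih j (by omega))
      · rfl
  refine ⟨fun n => (S n).1 n, fun n => (S n).2, rfl, rfl, fun n => ?_⟩
  rw [← hF n (S n).1 (fun n => (S n).1 n) (S n).2 (hagree n)]
  exact Prod.ext (Function.update_self _ _ _) rfl

section Main

variable {X Y : Type*} [NormedAddCommGroup X] [InnerProductSpace ℝ X] [CompleteSpace X]
  [NormedAddCommGroup Y] [InnerProductSpace ℝ Y] [CompleteSpace Y]

lemma min_max_mem_Icc (P : Params) (q : ℝ) :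
    min P.γmax (max P.γmin q) ∈ Set.Icc P.γmin P.γmax :=
  ⟨le_min P.γmin_lt_γmax.le (le_max_left _ _), min_le_left _ _⟩

theorem exists_isRun {φ : X → EReal} (hφ : ProperClosedConvex φ) {𝔄 : Set Y}
    (h𝔄_closed : IsClosed 𝔄) (h𝔄_convex : Convex ℝ 𝔄)
    (A : X →L[ℝ] Y) (xk : X) (b : Y) (z : X) {r : ℝ} (hr : 0 < r) (P : Params) {θ₁ : Y}
    (hθ₁ : θ₁ ∈ 𝔄) :
    ∃ (p : ℕ → X) (θ μ s : ℕ → Y) (γ lam : ℕ → ℝ),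
      IsRun φ 𝔄 A xk b z r P θ₁ p θ μ s γ lam := by
  choose pf hpf using fun θ : Y =>
    hφ.exists_prox_eq_singleton hr (z - r • ContinuousLinearMap.adjoint A θ)
  choose pr hpr using fun u : Y => exists_isProj ⟨θ₁, hθ₁⟩ h𝔄_closed h𝔄_convex u
  set d := dualObj φ A xk b z r
  set m : Y → Y := fun θ => ell A xk b (pf θ)
  have hd : SmoothConcave d m (r * ‖A‖ ^ 2) :=
    smoothConcave_dualObj hφ A xk b z hr fun θ => by rw [hpf]; rfl
  let dir : Y → ℝ → Y := fun θ g => pr (θ + g • m θ) - θ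
  let len : ℕ → (ℕ → Y) → ℝ → ℝ := fun n h g => stepLength P d h (m (h n)) (dir (h n) g) n
  let next : ℕ → (ℕ → Y) → ℝ → Y := fun n h g => h n + len n h g • dir (h n) g
  let spec : ℕ → (ℕ → Y) → ℝ → ℝ := fun n h g =>
    inner ℝ (m (h n) - m (next n h g)) (dir (h n) g)
  obtain ⟨θ, γ, hθ0, hγ0, hstep⟩ := exists_seq_of_history θ₁ P.γ₁
    (fun n h g => (next n h g, if spec n h g = 0 then P.γmin else
      min P.γmax (max P.γmin (len n h g * ‖dir (h n) g‖ ^ 2 / spec n h g))))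
    (fun n h h' g hh => by
      have e1 : len n h g = len n h' g := by
        simp only [len, hh n le_rfl, stepLength_congr P d hh]
      have e2 : next n h g = next n h' g := by simp only [next, e1, hh n le_rfl]
      simp only [spec, e2, e1, hh n le_rfl])
  have hθs : ∀ n, θ (n + 1) = next n θ (γ n) := fun n => congrArg Prod.fst (hstep n)
  have hγs : ∀ n, γ (n + 1) = if spec n θ (γ n) = 0 then P.γmin else
      min P.γmax (max P.γmin (len n θ (γ n) * ‖dir (θ n) (γ n)‖ ^ 2 / spec n θ (γ n))) :=
    fun n => congrArg Prod.snd (hstep n)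
  have hspec : ∀ n, spec n θ (γ n) = inner ℝ (m (θ n) - m (θ (n + 1))) (dir (θ n) (γ n)) :=
    fun n => by rw [hθs]
  have hγmem : ∀ n, γ n ∈ Set.Icc P.γmin P.γmax := by
    intro n
    cases n with
    | zero => rw [hγ0]; exact P.γ₁_mem
    | succ n =>
      rw [hγs]
      split_ifs
      · exact ⟨le_rfl, P.γmin_lt_γmax.le⟩
      · exact min_max_mem_Icc P _
  have hproj : ∀ n, IsProj 𝔄 (θ n + γ n • m (θ n)) (θ n + dir (θ n) (γ n)) := fun n => by
    simp only [dir, add_sub_cancel]; exact hpr _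
  have hmem : ∀ n, θ n ∈ 𝔄 := iterate_mem (lam := fun n => len n θ (γ n)) h𝔄_convex (hθ0 ▸ hθ₁)
    (fun n => (hproj n).1)
    (fun n => ⟨(backtrack_iterate_mem P d _ _ _ _).1.le, backtrack_iterate_le_one P d _ _ _ _⟩) hθs
  refine ⟨fun n => pf (θ n), θ, fun n => m (θ n), fun n => dir (θ n) (γ n), γ,
    fun n => len n θ (γ n), hθ0, hγ0, fun n => hpf _, fun n => rfl, fun n hn => ?_,
    fun n hn => ?_, hproj, fun n => ?_, hθs⟩
  · rw [hγs, hspec, if_neg hn]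
  · rw [hγs, hspec, if_pos hn]
    exact ⟨le_rfl, P.γmin_lt_γmax.le⟩
  · have hs := ((hproj n).sq_norm_step_le h𝔄_convex (P.γmin_pos.trans_le (hγmem n).1)
      (hγmem n).2 (hmem n)).2
    have hne := hd.exists_accept (by positivity) P hs
    exact ⟨_, rfl, Nat.sInf_mem hne, fun j hj => Nat.notMem_of_lt_sInf hj⟩

/-- The primal iterates converge strongly for every run: their error is controlled by the dual
optimality gap. -/
theorem IsRun.tendsto {φ : X → EReal} (hφ : ProperClosedConvex φ) {𝔄 : Set Y}
    (h𝔄_closed : IsClosed 𝔄) (h𝔄_convex : Convex ℝ 𝔄) (h𝔄_bdd : Bornology.IsBounded 𝔄)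
    {A : X →L[ℝ] Y} {xk : X} {b : Y} {z : X} {r : ℝ} (hr : 0 < r) {P : Params} {θ₁ : Y}
    (hθ₁ : θ₁ ∈ 𝔄) {p : ℕ → X} {θ μ s : ℕ → Y} {γ lam : ℕ → ℝ}
    (h : IsRun φ 𝔄 A xk b z r P θ₁ p θ μ s γ lam) :
    ∃ θbar : Y, IsDualSolution φ 𝔄 A xk b z r θbar ∧
      (∀ v : Y, Tendsto (fun n => (inner ℝ (θ n) v : ℝ)) atTop (𝓝 (inner ℝ θbar v))) ∧
      ∃ pbar : X, prox (scale r (psi φ 𝔄 A xk b)) z = {pbar} ∧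
        prox (scale r φ) (z - r • ContinuousLinearMap.adjoint A θbar) = {pbar} ∧
        Tendsto p atTop (𝓝 pbar) := by
  choose pf hpf using fun θ : Y =>
    hφ.exists_prox_eq_singleton hr (z - r • ContinuousLinearMap.adjoint A θ)
  have hpf' : ∀ θ, pf θ ∈ prox (scale r φ) (z - r • ContinuousLinearMap.adjoint A θ) :=
    fun θ => by rw [hpf]; rfl
  have hp : ∀ n, p n = pf (θ n) := fun n =>
    (Set.singleton_eq_singleton_iff.1 ((hpf (θ n)).symm.trans (h.prox_eq n))).symm
  set d := dualObj φ A xk b z r with hddef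
  set m : Y → Y := fun θ => ell A xk b (pf θ) with hm
  have hd : SmoothConcave d m (r * ‖A‖ ^ 2) := smoothConcave_dualObj hφ A xk b z hr hpf'
  have hμ : ∀ n, μ n = m (θ n) := fun n => by rw [h.μ_eq, hp]
  have hγ : ∀ n, γ n ∈ Set.Icc P.γmin P.γmax := by
    intro n
    cases n with
    | zero => rw [h.γ_zero]; exact P.γ₁_mem
    | succ n =>
      by_cases h0 : inner ℝ (μ n - μ (n + 1)) (s n) = 0
      · exact h.γ_succ_of_eq_zero n h0
      · rw [h.γ_succ n h0]; exact min_max_mem_Icc P _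
  obtain ⟨w, hwmem, hwmax, hweak, hval⟩ := hd.tendsto_spg (by positivity) P h𝔄_closed h𝔄_convex
    h𝔄_bdd (h.θ_zero ▸ hθ₁) hγ (fun n => hμ n ▸ h.proj n) (fun n => hμ n ▸ h.line_search n)
    h.θ_succ
  have hopt : ∀ v ∈ 𝔄, inner ℝ (m w) (v - w) ≤ 0 := fun v hv =>
    hd.inner_le_of_isMaxOn h𝔄_convex hwmem hwmax hv
  refine ⟨w, ⟨hwmem, fun v hv => ?_⟩, hweak, pf w,
    prox_psi_eq_singleton hφ A xk b z hr hwmem (hpf' w) hopt, hpf w, ?_⟩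
  · rw [← coe_dualObj hφ A xk b z hr, ← coe_dualObj hφ A xk b z hr, EReal.coe_le_coe_iff]
    exact hwmax hv
  · have hmem : ∀ n, θ n ∈ 𝔄 := iterate_mem h𝔄_convex (h.θ_zero ▸ hθ₁) (fun n => (h.proj n).1)
      (fun n => by
        obtain ⟨i, hi, -⟩ := h.line_search n
        rw [hi]
        exact ⟨(backtrack_iterate_mem P d _ _ _ i).1.le, backtrack_iterate_le_one P d _ _ _ i⟩)
      h.θ_succ
    have hbound : ∀ n, ‖p n - pf w‖ ^ 2 ≤ 2 * r * (d w - d (θ n)) := fun n => by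
      have h1 := dist_prox_le hφ A xk b z hr (hpf' w) (hpf' (θ n))
      have h2 := hopt (θ n) (hmem n)
      have h3 : 1 / (2 * r) * ‖pf w - pf (θ n)‖ ^ 2 ≤ d w - d (θ n) := by linarith
      rw [hp, norm_sub_rev]
      calc ‖pf w - pf (θ n)‖ ^ 2 = 2 * r * (1 / (2 * r) * ‖pf w - pf (θ n)‖ ^ 2) := by field_simp
        _ ≤ _ := mul_le_mul_of_nonneg_left h3 (by positivity)
    have hlim : Tendsto (fun n => Real.sqrt (2 * r * (d w - d (θ n)))) atTop (𝓝 0) := by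
      have h1 := (hval.const_sub (d w)).const_mul (2 * r)
      rw [sub_self, mul_zero] at h1
      have h2 := (Real.continuous_sqrt.tendsto _).comp h1
      rwa [Real.sqrt_zero] at h2
    rw [tendsto_iff_norm_sub_tendsto_zero]
    exact squeeze_zero (fun n => norm_nonneg _) (fun n => Real.le_sqrt_of_sq_le (hbound n)) hlim

end Main

end ProxDual

theorem mainTheorem10 {X Y : Type*}
    [NormedAddCommGroup X] [InnerProductSpace ℝ X] [CompleteSpace X]
    [NormedAddCommGroup Y] [InnerProductSpace ℝ Y] [CompleteSpace Y]
    (φ : X → EReal) (hφ : ProxDual.ProperClosedConvex φ)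
    (𝔄 : Set Y) (h𝔄_ne : 𝔄.Nonempty) (h𝔄_closed : IsClosed 𝔄) (h𝔄_convex : Convex ℝ 𝔄)
    (h𝔄_bdd : Bornology.IsBounded 𝔄)
    (A : X →L[ℝ] Y) (xk : X) (b : Y) (z : X) (r : ℝ) (hr : 0 < r)
    (P : ProxDual.Params) (θ₁ : Y) (hθ₁ : θ₁ ∈ 𝔄) :
    -- the algorithm is well defined (in particular every line search terminates)
    (∃ (p : ℕ → X) (θ μ s : ℕ → Y) (γ lam : ℕ → ℝ),
      ProxDual.IsRun φ 𝔄 A xk b z r P θ₁ p θ μ s γ lam) ∧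
    -- and all sequences that it generates converge
    ∀ (p : ℕ → X) (θ μ s : ℕ → Y) (γ lam : ℕ → ℝ),
      ProxDual.IsRun φ 𝔄 A xk b z r P θ₁ p θ μ s γ lam →
      ∃ θbar : Y, ProxDual.IsDualSolution φ 𝔄 A xk b z r θbar ∧
        (∀ v : Y, Tendsto (fun n => (inner ℝ (θ n) v : ℝ)) atTop (𝓝 (inner ℝ θbar v))) ∧
        ∃ pbar : X,
          ProxDual.prox (ProxDual.scale r (ProxDual.psi φ 𝔄 A xk b)) z = {pbar} ∧
          ProxDual.prox (ProxDual.scale r φ)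
            (z - r • ContinuousLinearMap.adjoint A θbar) = {pbar} ∧
          ((IsCompactOperator A ∨ FiniteDimensional ℝ Y ∨
              ∃ ε : ℝ, 0 < ε ∧ ε < 1 ∧ ε * (r * ‖A‖ ^ 2) < 1 ∧
                ∀ n, ε ≤ γ n ∧ (γ n + ε) * (r * ‖A‖ ^ 2) ≤ 2 ∧ ε ≤ lam n ∧ lam n ≤ 1) →
            Tendsto p atTop (𝓝 pbar)) := by
  refine ⟨ProxDual.exists_isRun hφ h𝔄_closed h𝔄_convex A xk b z hr P hθ₁,
    fun p θ μ s γ lam h => ?_⟩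
  obtain ⟨θbar, hsol, hweak, pbar, hpsi, hphi, hlim⟩ :=
    h.tendsto hφ h𝔄_closed h𝔄_convex h𝔄_bdd hr hθ₁
  exact ⟨θbar, hsol, hweak, pbar, hpsi, hphi, fun _ => hlim⟩
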